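/- Let $N\ge 3$, let $\lambda\ge 0$, and let $V^+=\max\{V,0\}$ denote the positive part of $V$. Let $V:\mathbb R^N\to\mathbb R$ be a Hölder continuous function such that (V) $V\in L^\infty(\mathbb R^N)$, $V^+\not\equiv 0$, and $V^+=V_1+V_2$ with $V_1\in L^{N/2}(\mathbb R^N)$ and $\lim_{|x|\to\infty}|x|^2V_2(x)=0$; and suppose moreover that there are $A,\alpha>0$ such that $V^+(x)\le A|x|^{-2-\alpha}$ for all $x\in\mathbb R^N\setminus\{0\}$. Let $f:[0,\infty)\to[0,\infty)$ be a $C^1$ function such that (f1) $f(0)=f'(0)=0$ and $\liminf_{t\searrow 0} f'(t)/t>0$ (possibly $+\infty$); (f2) $t\mapsto f(t)/t$ is increasing (in the wide sense) on $(0,\infty)$; (f3) $\lim_{t\to+\infty} f(t)/t>\|V\|_{L^\infty(\mathbb R^N)}$ (the limit may be $+\infty$). Let $u$ be an arbitrary classical solution of $$-\Delta u=\lambda\,(V(x)u-f(u))\ \text{ in }\mathbb R^N,\qquad u>0\ \text{ in }\mathbb R^N,\qquad \lim_{|x|\to\infty}u(x)=0,$$ that is, a function $u\in C^2(\mathbb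 R^N)$ satisfying these conditions pointwise. Then there exists a constant $C>0$ such that $$|u(x)|\le C|x|^{2-N}\qquad\text{for all }x\in\mathbb R^N\setminus\{0\}.$$ -/

import Mathlib

open Filter Topology MeasureTheory Set
open scoped ENNReal NNReal

/-- The positive part `V⁺(x) = max (V(x), 0)` of a real function. -/
def posPartFun {X : Type*} (V : X → ℝ) (x : X) : ℝ := max (V x) 0

/-- The standing condition `(V)` on the potential `V : ℝ^N → ℝ`: it is Hölder continuous and
essentially bounded, `V⁺` is not identically zero, and `V⁺ = V₁ + V₂` with `V₁ ∈ L^{N/2}(ℝ^N)` and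
`|x|² V₂(x) → 0` as `|x| → ∞`. -/
structure ConditionV {N : ℕ} (V : EuclideanSpace ℝ (Fin N) → ℝ) : Prop where
  holder : ∃ K γ : ℝ≥0, 0 < γ ∧ γ ≤ 1 ∧ HolderWith K γ V
  bounded : MemLp V ∞ volume
  posPart_ne_zero : posPartFun V ≠ 0
  decomposition : ∃ V₁ V₂ : EuclideanSpace ℝ (Fin N) → ℝ,
    (∀ x, posPartFun V x = V₁ x + V₂ x) ∧
    MemLp V₁ ((N : ℝ≥0∞) / 2) volume ∧
    Tendsto (fun x => ‖x‖ ^ 2 * V₂ x) (Bornology.cobounded _) (𝓝 0)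

/-- The growth restriction `V⁺(x) ≤ A |x|^{-2-α}` for some `A, α > 0`. At `x = 0` the right-hand
side is `+∞`, so that nothing is asked there. -/
def DecayBound {N : ℕ} (V : EuclideanSpace ℝ (Fin N) → ℝ) : Prop :=
  ∃ A α : ℝ, 0 < A ∧ 0 < α ∧
    ∀ x : EuclideanSpace ℝ (Fin N), x ≠ 0 → posPartFun V x ≤ A * ‖x‖ ^ (-2 - α)

/-- `f` restricts to a `C¹` function `[0,∞) → [0,∞)` (one-sided derivative at `0`). The values of
`f` on the negative half-line play no role. -/
structure IsC1Nonneg (f : ℝ → ℝ) : Prop where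
  contDiffOn : ContDiffOn ℝ 1 f (Ici 0)
  nonneg : ∀ t, 0 ≤ t → 0 ≤ f t

/-- Condition `(f1)`: `f(0) = f'(0) = 0` and `liminf_{t ↘ 0} f'(t)/t > 0`, the lower limit being
taken in the extended reals (it may be `+∞`). -/
structure ConditionF1 (f : ℝ → ℝ) : Prop where
  map_zero : f 0 = 0
  deriv_zero : derivWithin f (Ici 0) 0 = 0
  liminf_pos :
    (0 : EReal) < liminf (fun t : ℝ => ((derivWithin f (Ici 0) t / t : ℝ) : EReal)) (𝓝[>] 0)

/-- Condition `(f2)`: `t ↦ f(t)/t` is increasing (in the wide sense) on `(0,∞)`. -/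
def ConditionF2 (f : ℝ → ℝ) : Prop :=
  MonotoneOn (fun t => f t / t) (Ioi 0)

/-- Condition `(f3)`: `lim_{t → +∞} f(t)/t > ‖V‖_{L^∞}`, the limit being taken in the extended
reals (it may be `+∞`). -/
def ConditionF3 {N : ℕ} (V : EuclideanSpace ℝ (Fin N) → ℝ) (f : ℝ → ℝ) : Prop :=
  ∃ L : EReal, Tendsto (fun t : ℝ => ((f t / t : ℝ) : EReal)) atTop (𝓝 L) ∧
    ((eLpNorm V ∞ volume : ℝ≥0∞) : EReal) < L

/-- `u` is a (classical) solution of the decaying problem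
`-Δu = lam (V u - f(u))` in `ℝ^N`, `u > 0` in `ℝ^N`, `u(x) → 0` as `|x| → ∞`. -/
structure IsDecayingSolution {N : ℕ} (V : EuclideanSpace ℝ (Fin N) → ℝ) (f : ℝ → ℝ) (lam : ℝ)
    (u : EuclideanSpace ℝ (Fin N) → ℝ) : Prop where
  contDiff : ContDiff ℝ 2 u
  equation : ∀ x, -(Laplacian.laplacian u x) = lam * (V x * u x - f (u x))
  pos : ∀ x, 0 < u x
  tendsto_zero : Tendsto u (Bornology.cobounded _) (𝓝 0)

/-! Since `f ≥ 0` and `u > 0`, the equation gives `-Δu ≤ q u` with `q = lam V⁺ = O(|x|^{-2-α})`. For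
`0 < s < min(α, 1)`, the barrier `W = C(|x|^{2-N} - |x|^{2-N-s})` satisfies `-ΔW = C
s(N-2+s)|x|^{-N-s}`, because `|x|^{2-N}` is harmonic. As `s < α`, this exceeds `q W` far out, so `W`
is a supersolution there. The sign of `q` prevents a direct maximum principle for `-Δ - q`. Dividing
by the positive strict supersolution `1 + |x|^{-s}` restores it (`nonpos_of_subsolution_exterior`),
whence `u ≤ W ≤ C|x|^{2-N}` outside a ball. -/

section LaplacianMaximumPrinciple

variable {E : Type*} [NormedAddCommGroup E] [InnerProductSpace ℝ E]

/-! ### Derivatives of powers of the norm. -/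

theorem hasFDerivAt_norm_rpow_of_ne_zero {x : E} (hx : x ≠ 0) (p : ℝ) :
    HasFDerivAt (fun y : E => ‖y‖ ^ p) ((p * ‖x‖ ^ (p - 2)) • innerSL ℝ x) x := by
  convert! ((hasStrictFDerivAt_norm_sq x).rpow_const (p := p / 2) (by simp [hx])).hasFDerivAt
    using 0
  simp_rw [← Real.rpow_natCast_mul (norm_nonneg _), ← Nat.cast_smul_eq_nsmul ℝ, smul_smul]
  ring_nf

theorem contDiffAt_norm_rpow_of_ne_zero {x : E} (hx : x ≠ 0) (p : ℝ) {n : WithTop ℕ∞} :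
    ContDiffAt ℝ n (fun y : E => ‖y‖ ^ p) x :=
  (contDiffAt_norm ℝ hx).rpow_const_of_ne (norm_ne_zero_iff.2 hx)

theorem fderiv_fderiv_norm_rpow {x : E} (hx : x ≠ 0) (p : ℝ) (e : E) :
    fderiv ℝ (fderiv ℝ (fun y : E => ‖y‖ ^ p)) x e e =
      p * (p - 2) * ‖x‖ ^ (p - 4) * inner ℝ x e ^ 2 + p * ‖x‖ ^ (p - 2) * ‖e‖ ^ 2 := by
  have hev : fderiv ℝ (fun y : E => ‖y‖ ^ p) =ᶠ[𝓝 x]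
      fun y => (p * ‖y‖ ^ (p - 2)) • innerSL ℝ y := by
    filter_upwards [isOpen_ne.mem_nhds hx] with y hy
    exact (hasFDerivAt_norm_rpow_of_ne_zero hy p).fderiv
  have hd : HasFDerivAt (fun y : E => (p * ‖y‖ ^ (p - 2)) • innerSL ℝ y) _ x :=
    ((hasFDerivAt_norm_rpow_of_ne_zero hx (p - 2)).const_mul p).smul
      (innerSL ℝ (E := E)).hasFDerivAt
  have he : innerSL ℝ e e = ‖e‖ ^ 2 := real_inner_self_eq_norm_sq e
  rw [hev.fderiv_eq, hd.fderiv]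
  simp [he]
  ring_nf

variable [FiniteDimensional ℝ E]

theorem laplacian_norm_rpow {x : E} (hx : x ≠ 0) (p : ℝ) :
    Laplacian.laplacian (fun y : E => ‖y‖ ^ p) x =
      p * (p + Module.finrank ℝ E - 2) * ‖x‖ ^ (p - 2) := by
  have hpow : ‖x‖ ^ (p - 4) * ‖x‖ ^ 2 = ‖x‖ ^ (p - 2) := by
    rw [← Real.rpow_natCast, ← Real.rpow_add (norm_pos_iff.2 hx)]
    norm_num
    ring_nf
  rw [InnerProductSpace.laplacian_eq_iteratedFDeriv_stdOrthonormalBasis]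
  simp only [iteratedFDeriv_two_apply, Matrix.cons_val_zero, Matrix.cons_val_one,
    fderiv_fderiv_norm_rpow hx, Finset.sum_add_distrib, ← Finset.mul_sum,
    OrthonormalBasis.sum_sq_inner_left, OrthonormalBasis.norm_eq_one]
  simp
  linear_combination p * (p - 2) * hpow

/-! ### Maximum and comparison principles. -/

theorem IsLocalMax.deriv_deriv_nonpos {g : ℝ → ℝ} {t : ℝ} (h : IsLocalMax g t)
    (hc : ContinuousAt g t) : deriv (deriv g) t ≤ 0 := by
  by_contra! hpos
  -- A point that is both a local maximum and a local minimum has `g` constant nearby, which forces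
  -- `g'' = 0`.
  have hmin := isLocalMin_of_deriv_deriv_pos hpos h.deriv_eq_zero hc
  have heq : g =ᶠ[𝓝 t] fun _ => g t := by
    filter_upwards [h, hmin] with s h₁ h₂ using le_antisymm h₁ h₂
  have := heq.deriv.deriv_eq
  simp at this
  linarith

/-- Each second derivative along a vector of an orthonormal basis is that of a one-variable function
with a local maximum at `0`. -/
theorem IsLocalMax.laplacian_nonpos {f : E → ℝ} {x : E} (h : IsLocalMax f x)
    (hf : ContDiffAt ℝ 2 f x) : Laplacian.laplacian f x ≤ 0 := by
  rw [InnerProductSpace.laplacian_eq_iteratedFDeriv_stdOrthonormalBasis]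
  refine Finset.sum_nonpos fun i _ => ?_
  generalize stdOrthonormalBasis ℝ E i = e
  simp only [iteratedFDeriv_two_apply, Matrix.cons_val_zero, Matrix.cons_val_one]
  have hl : ∀ t : ℝ, HasDerivAt (fun s : ℝ => x + s • e) e t := fun t => by
    simpa using ((hasDerivAt_id t).smul_const e).const_add x
  have hlc : Tendsto (fun s : ℝ => x + s • e) (𝓝 0) (𝓝 x) := by
    simpa [ContinuousAt] using (hl 0).continuousAt
  have hd1 : deriv (fun s : ℝ => f (x + s • e)) =ᶠ[𝓝 0] fun s => fderiv ℝ f (x + s • e) e := by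
    filter_upwards [hlc.eventually (hf.eventually (by simp))] with s hs
    exact ((hs.differentiableAt (by simp)).hasFDerivAt.comp_hasDerivAt s (hl s)).deriv
  have hd2 : HasFDerivAt (fderiv ℝ f) (fderiv ℝ (fderiv ℝ f) x) (x + (0 : ℝ) • e) := by
    have hf' : ContDiffAt ℝ 1 (fderiv ℝ f) x := hf.fderiv_right (by norm_num)
    rw [zero_smul, add_zero]
    exact (hf'.differentiableAt (by simp)).hasFDerivAt
  have hd3 : deriv (fun s : ℝ => fderiv ℝ f (x + s • e) e) 0 = fderiv ℝ (fderiv ℝ f) x e e := by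
    have hd4 : HasDerivAt (fun s : ℝ => fderiv ℝ f (x + s • e)) (fderiv ℝ (fderiv ℝ f) x e) 0 :=
      hd2.comp_hasDerivAt (0 : ℝ) (hl 0)
    exact ((ContinuousLinearMap.apply ℝ ℝ e).hasFDerivAt.comp_hasDerivAt (0 : ℝ) hd4).deriv
  rw [← hd3, ← hd1.deriv_eq]
  have hmax : IsLocalMax (fun s : ℝ => f (x + s • e)) 0 := by
    have := hlc.eventually h
    simpa [IsLocalMax, IsMaxFilter] using this
  refine hmax.deriv_deriv_nonpos ?_
  have hcf : ContinuousAt f (x + (0 : ℝ) • e) := by simpa using hf.continuousAt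
  exact ContinuousAt.comp (f := fun s : ℝ => x + s • e) hcf (hl 0).continuousAt

/-- Comparison principle in an exterior domain for `-Δ - q`, in the presence of a strict
supersolution `φ` bounded below by `1`. -/
theorem nonpos_of_subsolution_exterior {R : ℝ} {q v φ : E → ℝ}
    (hv : ∀ x, R ≤ ‖x‖ → ContDiffAt ℝ 2 v x) (hφ : ∀ x, R ≤ ‖x‖ → ContDiffAt ℝ 2 φ x)
    (hφ1 : ∀ x, R ≤ ‖x‖ → 1 ≤ φ x)
    (hφs : ∀ x, R < ‖x‖ → q x * φ x < -Laplacian.laplacian φ x)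
    (hvs : ∀ x, R < ‖x‖ → -Laplacian.laplacian v x ≤ q x * v x)
    (hbd : ∀ x, ‖x‖ = R → v x ≤ 0) (hlim : Tendsto v (Bornology.cobounded E) (𝓝 0))
    {x : E} (hx : R ≤ ‖x‖) : v x ≤ 0 := by
  by_contra! hpos
  have hclosed : IsClosed {y : E | R ≤ ‖y‖} := isClosed_le continuous_const continuous_norm
  have hcont : ContinuousOn (fun y => v y / φ y) {y : E | R ≤ ‖y‖} := fun y hy =>
    ((hv y hy).continuousAt.div (hφ y hy).continuousAt
      (by linarith [hφ1 y hy] : (0 : ℝ) < φ y).ne').continuousWithinAt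
  have hqx : 0 < v x / φ x := div_pos hpos (by linarith [hφ1 x hx])
  -- The maximum is attained: far out `v / φ` falls below its positive value at `x`, because `v → 0`
  -- and `φ ≥ 1`.
  obtain ⟨z, hz, hmax⟩ := hcont.exists_isMaxOn' hclosed hx (by
    rw [← Metric.cobounded_eq_cocompact, eventually_inf_principal]
    filter_upwards [hlim.eventually (gt_mem_nhds hqx)] with y hy hyR
    have h1 := hφ1 y hyR
    rw [div_le_iff₀ (by linarith)]
    nlinarith)
  have hφz : 0 < φ z := by linarith [hφ1 z hz]
  set M := v z / φ z with hM
  have hMpos : 0 < M := hqx.trans_le (hmax hx)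
  have hvz : v z = M * φ z := by rw [hM]; field_simp
  have hzR : R < ‖z‖ := by
    refine lt_of_le_of_ne hz fun h => ?_
    have := hbd z h.symm
    nlinarith [mul_pos hMpos hφz]
  -- `Mφ` touches `v` from above at `z`, so `-Δv ≥ -MΔφ > q M φ = q v` there, against the
  -- subsolution inequality.
  have hloc : IsLocalMax (v - M • φ) z := by
    filter_upwards [(isOpen_lt continuous_const continuous_norm).mem_nhds hzR] with y hy
    have h1 : v y / φ y ≤ M := hmax (le_of_lt hy : R ≤ ‖y‖)
    have h2 := hφ1 y (le_of_lt hy)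
    rw [div_le_iff₀ (by linarith)] at h1
    simp only [Pi.sub_apply, Pi.smul_apply, smul_eq_mul]
    linarith
  have hMφ : ContDiffAt ℝ 2 (M • φ) z := contDiffAt_const.smul (hφ z hz)
  have hlap := hloc.laplacian_nonpos ((hv z hz).sub hMφ)
  rw [(hv z hz).laplacian_sub hMφ, InnerProductSpace.laplacian_smul M (hφ z hz),
    smul_eq_mul] at hlap
  have h1 := hvs z hzR
  have h2 := mul_lt_mul_of_pos_left (hφs z hzR) hMpos
  rw [hvz] at h1
  linarith

end LaplacianMaximumPrinciple

/-! ### Decay of subsolutions. -/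

/-- A subsolution of `-Δ - q` that vanishes at infinity is bounded above by a multiple of the
fundamental solution as soon as the potential `q` is `O(|x|^{-2-α})` with `α > 0`. -/
theorem exists_le_norm_rpow_of_subsolution {N : ℕ} (hN : 3 ≤ N)
    {u q : EuclideanSpace ℝ (Fin N) → ℝ} {B α : ℝ} (hα : 0 < α)
    (hu : ContDiff ℝ 2 u) (hlim : Tendsto u (Bornology.cobounded _) (𝓝 0))
    (hq : ∀ x, x ≠ 0 → q x ≤ B * ‖x‖ ^ (-2 - α))
    (hsub : ∀ x, -Laplacian.laplacian u x ≤ q x * u x) :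
    ∃ C : ℝ, 0 < C ∧ ∀ x, x ≠ 0 → u x ≤ C * ‖x‖ ^ (2 - (N : ℝ)) := by
  have hN' : (3 : ℝ) ≤ N := by exact_mod_cast hN
  obtain ⟨s, hs0, hs1, hsα⟩ : ∃ s : ℝ, 0 < s ∧ s < 1 ∧ s < α :=
    ⟨min α 1 / 2, by positivity, by linarith [min_le_right α 1],
      by linarith [min_le_left α 1, lt_min hα one_pos]⟩
  -- As `N ≥ 3`, `s(1-s)` bounds both `s(N-2-s)` and `s(N-2+s)` from below; the factor 2 absorbs `1
  -- + |x|^{-s} < 2`.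
  obtain ⟨R, hR, hR1⟩ : ∃ R : ℝ, (∀ r, R ≤ r → 2 * |B| < s * (1 - s) * r ^ (α - s)) ∧ 1 < R := by
    have h := (tendsto_rpow_atTop (sub_pos.2 hsα)).const_mul_atTop
      (mul_pos hs0 (sub_pos.2 hs1))
    obtain ⟨R, hR⟩ := eventually_atTop.1 (h.eventually_gt_atTop (2 * |B|))
    exact ⟨max R 2, fun r hr => hR r ((le_max_left _ _).trans hr),
      lt_of_lt_of_le one_lt_two (le_max_right _ _)⟩
  -- the pointwise estimate of the potential
  have hqR : ∀ x : EuclideanSpace ℝ (Fin N), R ≤ ‖x‖ →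
      2 * q x < s * (1 - s) * ‖x‖ ^ (-s - 2) := by
    intro x hx
    have hx0 : 0 < ‖x‖ := by linarith
    have h1 := hq x (norm_pos_iff.1 hx0)
    have h2 : ‖x‖ ^ (-s - 2) = ‖x‖ ^ (α - s) * ‖x‖ ^ (-2 - α) := by
      rw [← Real.rpow_add hx0]; ring_nf
    have h3 : 0 < ‖x‖ ^ (-2 - α) := Real.rpow_pos_of_pos hx0 _
    have h4 := mul_lt_mul_of_pos_right (hR _ hx) h3
    have h5 := mul_le_mul_of_nonneg_right (le_abs_self B) h3.le
    rw [h2]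
    linarith
  have hne : ∀ x : EuclideanSpace ℝ (Fin N), R ≤ ‖x‖ → x ≠ 0 := fun x hx =>
    norm_pos_iff.1 (by linarith)
  have hpc : ∀ (p : ℝ) (x : EuclideanSpace ℝ (Fin N)), R ≤ ‖x‖ →
      ContDiffAt ℝ 2 (fun y : EuclideanSpace ℝ (Fin N) => ‖y‖ ^ p) x := fun p x hx =>
    contDiffAt_norm_rpow_of_ne_zero (hne x hx) p
  have hspos : ∀ x : EuclideanSpace ℝ (Fin N), R ≤ ‖x‖ → 0 < ‖x‖ ^ (-s) ∧ ‖x‖ ^ (-s) < 1 :=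
    fun x hx => ⟨Real.rpow_pos_of_pos (by linarith) _,
      Real.rpow_lt_one_of_one_lt_of_neg (by linarith) (by linarith)⟩
  set P : EuclideanSpace ℝ (Fin N) → ℝ := fun y => ‖y‖ ^ (-s) with hP
  set G : EuclideanSpace ℝ (Fin N) → ℝ := fun y => ‖y‖ ^ (2 - (N : ℝ)) with hG
  set H : EuclideanSpace ℝ (Fin N) → ℝ := fun y => ‖y‖ ^ (2 - (N : ℝ) - s) with hH
  have hHG : ∀ x, R ≤ ‖x‖ → H x = G x * P x := fun x hx => by
    simp only [hH, hG, hP]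
    rw [← Real.rpow_add (by linarith)]; ring_nf
  have hGpos : ∀ x, x ≠ 0 → 0 < G x := fun x hx => Real.rpow_pos_of_pos (norm_pos_iff.2 hx) _
  obtain ⟨S, hS⟩ : ∃ S : ℝ, ∀ x, ‖x‖ ≤ R → u x ≤ S := by
    obtain ⟨S, hS⟩ := (isCompact_closedBall (0 : EuclideanSpace ℝ (Fin N)) R).bddAbove_image
      hu.continuous.continuousOn
    exact ⟨S, fun x hx => hS ⟨x, by simpa using hx, rfl⟩⟩
  set g : ℝ := R ^ (2 - (N : ℝ)) with hg
  have hg0 : 0 < g := Real.rpow_pos_of_pos (by linarith) _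
  have hδ : 0 < 1 - R ^ (-s) :=
    sub_pos.2 (Real.rpow_lt_one_of_one_lt_of_neg hR1 (by linarith))
  -- With this `C` the barrier equals `|S| + 1 > u` on the sphere `|x| = R`.
  set C : ℝ := (|S| + 1) / (g * (1 - R ^ (-s))) with hC
  have hC0 : 0 < C := by positivity
  have hCg : C * (g * (1 - R ^ (-s))) = |S| + 1 := by rw [hC]; field_simp
  have hle1 : R ^ (-s) ≥ 0 := Real.rpow_nonneg (by linarith) _
  refine ⟨C, hC0, fun x hx => ?_⟩
  rcases le_total ‖x‖ R with hxR | hxR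
  -- Inside the ball no comparison is needed: `|x|^{2-N}` decreases in `|x|`, and `C g ≥ |S| + 1`.
  · have h1 : g ≤ G x :=
      Real.rpow_le_rpow_of_nonpos (norm_pos_iff.2 hx) hxR (by linarith)
    have h2 := mul_le_mul_of_nonneg_left h1 hC0.le
    have h3 := mul_nonneg (mul_nonneg hC0.le hg0.le) hle1
    linarith [hS x hxR, le_abs_self S]
  have hWc : ∀ x, R ≤ ‖x‖ → ContDiffAt ℝ 2 (C • (G - H)) x := fun x hx =>
    contDiffAt_const.smul ((hpc _ x hx).sub (hpc _ x hx))
  have hG0 : ∀ t : ℝ, t < 0 → Tendsto (fun y : EuclideanSpace ℝ (Fin N) => ‖y‖ ^ t)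
      (Bornology.cobounded _) (𝓝 0) := fun t ht => by
    have := (tendsto_rpow_neg_atTop (neg_pos.2 ht)).comp
      (tendsto_norm_cobounded_atTop (E := EuclideanSpace ℝ (Fin N)))
    simpa [Function.comp_def] using this
  have key := nonpos_of_subsolution_exterior (R := R) (q := q) (v := u - C • (G - H))
    (φ := (fun _ => (1 : ℝ)) + P) (x := x)
    (fun y hy => hu.contDiffAt.sub (hWc y hy))
    (fun y hy => contDiffAt_const.add (hpc _ y hy))
    (fun y hy => by simpa using (hspos y hy).1.le) ?_ ?_ ?_ ?_ hxR
  · have h1 : H x = G x * P x := hHG x hxR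
    have h2 := mul_nonneg hC0.le (mul_nonneg (hGpos x hx).le (hspos x hxR).1.le)
    simp only [Pi.sub_apply, Pi.smul_apply, smul_eq_mul, h1] at key
    change u x ≤ C * G x
    linarith
  · intro y hy
    rw [contDiffAt_const.laplacian_add (hpc _ y hy.le), InnerProductSpace.laplacian_const,
      laplacian_norm_rpow (hne y hy.le)]
    have h1 := hqR y hy.le
    obtain ⟨h2, h3⟩ := hspos y hy.le
    have h4 : 0 < ‖y‖ ^ (-s - 2) := Real.rpow_pos_of_pos (by linarith) _
    have h5 : s * (1 - s) * ‖y‖ ^ (-s - 2) ≤ s * (N - 2 - s) * ‖y‖ ^ (-s - 2) := by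
      gcongr; linarith
    have h6 : 0 < s * (1 - s) * ‖y‖ ^ (-s - 2) := mul_pos (mul_pos hs0 (by linarith)) h4
    have h7 : q y * (1 + P y) < s * (1 - s) * ‖y‖ ^ (-s - 2) := by
      rcases le_total (q y) 0 with h | h
      · have : 0 < 1 + P y := by linarith
        nlinarith
      · nlinarith
    simp only [Pi.add_apply, Pi.zero_apply, finrank_euclideanSpace, Fintype.card_fin]
    linarith
  · intro y hy
    have hcG : ContDiffAt ℝ 2 G y := hpc _ y hy.le
    have hcH : ContDiffAt ℝ 2 H y := hpc _ y hy.le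
    have hsm := InnerProductSpace.laplacian_smul C (hcG.sub hcH)
    change Laplacian.laplacian (C • (G - H)) y = C • Laplacian.laplacian (G - H) y at hsm
    rw [hu.contDiffAt.laplacian_sub (hWc y hy.le), hsm, hcG.laplacian_sub hcH,
      laplacian_norm_rpow (hne y hy.le), laplacian_norm_rpow (hne y hy.le)]
    simp only [Pi.sub_apply, Pi.smul_apply, finrank_euclideanSpace, Fintype.card_fin, smul_eq_mul,
      hHG y hy.le]
    obtain ⟨h2, h3⟩ := hspos y hy.le
    have h1 := hqR y hy.le
    have hGy := hGpos y (hne y hy.le)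
    have h4 : ‖y‖ ^ (2 - (N : ℝ) - s - 2) = G y * ‖y‖ ^ (-s - 2) := by
      simp only [hG]
      rw [← Real.rpow_add (by linarith)]; ring_nf
    have h5 : 0 < ‖y‖ ^ (-s - 2) := Real.rpow_pos_of_pos (by linarith) _
    have h6 : q y * (1 - P y) ≤ s * (N - 2 + s) * ‖y‖ ^ (-s - 2) := by
      have : s * (1 - s) * ‖y‖ ^ (-s - 2) ≤ s * (N - 2 + s) * ‖y‖ ^ (-s - 2) := by
        gcongr; linarith
      have h7 : 0 < s * (1 - s) * ‖y‖ ^ (-s - 2) := mul_pos (mul_pos hs0 (by linarith)) h5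
      have : 0 < 1 - P y := by linarith
      rcases le_total (q y) 0 with h | h
      · nlinarith
      · nlinarith
    have h8 := mul_le_mul_of_nonneg_left h6 (mul_pos hC0 hGy).le
    rw [h4]
    linarith [hsub y]
  · intro y hy
    have h1 : H y = G y * P y := hHG y hy.ge
    have h2 : G y = g := by simp only [hG, hg, hy]
    have h3 : P y = R ^ (-s) := by simp only [hP, hy]
    simp only [Pi.sub_apply, Pi.smul_apply, smul_eq_mul, h1, h2, h3]
    linarith [hS y hy.le, le_abs_self S]
  · have h1 := ((hG0 (2 - N) (by linarith)).sub (hG0 (2 - N - s) (by linarith))).const_smul C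
    have h2 := hlim.sub h1
    rw [sub_zero, smul_zero, sub_zero] at h2
    exact h2

theorem proposition2 (N : ℕ) (hN : 3 ≤ N)
    (V : EuclideanSpace ℝ (Fin N) → ℝ) (hV : ConditionV V) (hVdecay : DecayBound V)
    (f : ℝ → ℝ) (hf : IsC1Nonneg f) (hf1 : ConditionF1 f) (hf2 : ConditionF2 f)
    (hf3 : ConditionF3 V f)
    (lam : ℝ) (hlam : 0 ≤ lam)
    (u : EuclideanSpace ℝ (Fin N) → ℝ) (hu : IsDecayingSolution V f lam u) :
    ∃ C : ℝ, 0 < C ∧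
      ∀ x : EuclideanSpace ℝ (Fin N), x ≠ 0 → |u x| ≤ C * ‖x‖ ^ (2 - (N : ℝ)) := by
  obtain ⟨A, α, -, hα, hdec⟩ := hVdecay
  obtain ⟨C, hC, hle⟩ := exists_le_norm_rpow_of_subsolution hN (q := fun x => lam * posPartFun V x)
    (B := lam * A) hα hu.contDiff hu.tendsto_zero
    (fun x hx => by
      rw [mul_assoc]
      exact mul_le_mul_of_nonneg_left (hdec x hx) hlam)
    -- Dropping `-f(u) ≤ 0` and replacing `V` by `V⁺` only enlarge the right-hand side.
    (fun x => by
      rw [hu.equation x, mul_assoc]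
      refine mul_le_mul_of_nonneg_left ?_ hlam
      have h1 : V x * u x ≤ posPartFun V x * u x :=
        mul_le_mul_of_nonneg_right (le_max_left _ _) (hu.pos x).le
      linarith [hf.nonneg (u x) (hu.pos x).le])
  exact ⟨C, hC, fun x hx => by rw [abs_of_pos (hu.pos x)]; exact hle x hx⟩
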